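/- Let $\log=\log_2$. For $N\in\{1,2,\dots\}$ and $1\le p<\infty$ let $\mathcal B_p^N$ be the set of all $f:\{0,\dots,N-1\}\to\mathbf R$ with $\big(\frac1N\sum_{i=0}^{N-1}|f(i)|^p\big)^{1/p}\le 1$, and for $M\in\{1,2,\dots\}$ put $$S'_{N,M}f=\frac1N\sum_{0\le i<N,\ |f(i)|\ge M} f(i).$$ Quantum algorithms are understood in the following query model, for functions from a nonempty set $D$ to a nonempty set $K$ and output in a normed space $G$; here $D=\{0,\dots,N-1\}$ and $K=G=\mathbf R$. Write $H_m=(\mathbf C^2)^{\otimes m}$, with canonical basis $|0\rangle,\dots,|2^m-1\rangle$. A quantum query is a tuple $Q=(m,m',m'',Z,\tau,\beta)$ with $m,m',m''\in\{1,2,\dots\}$, $m'+m''\le m$, $\emptyset\ne Z\subseteq\{0,\dots,2^{m'}-1\}$ and arbitrary maps $\tau:Z\to D$, $\beta:K\to\{0,\dots,2^{m''}-1\}$. For a function $f$ it defines the unitary operator $Q_f$ on $H_m=H_{m'}\otimes H_{m''}\otimes H_{m-m'-m''}$ with $Q_f|i\rangle|x\rangle|y\rangle=|i\rangle|x\oplus\beta(f(\tau(i)))\rangle|y\rangle$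 if $i\in Z$, where $\oplus$ is addition modulo $2^{m''}$, and $Q_f|i\rangle|x\rangle|y\rangle=|i\rangle|x\rangle|y\rangle$ otherwise. An algorithm without measurement consists of a query $Q$ and unitary operators $U_0,\dots,U_n$ on $H_m$ ($n\ge 0$); it uses $n$ queries, and $A_f=U_nQ_fU_{n-1}\cdots U_1Q_fU_0$ has the matrix $(A_f(x,y))$ in the canonical basis. A quantum algorithm $A$ consists of $k\ge1$ algorithms $A_0,\dots,A_{k-1}$ without measurement, on $m_0,\dots,m_{k-1}$ qubits, of a starting basis state $b_0$, of functions $b_\ell$ $(1\le\ell<k)$ that map earlier results $(x_0,\dots,x_{\ell-1})$ to a basis state index in $\{0,\dots,2^{m_\ell}-1\}$, and of an output map $\varphi:\prod_{\ell<k}\{0,\dots,2^{m_\ell}-1\}\to G$. On input $f$ its measurement results are $(x_0,\dots,x_{k-1})$ with probability $\prod_{\ell<k}|A_{\ell,f}(x_\ell,b_\ell(x_0,\dots,x_{\ell-1}))|^2$, and its random output $A(f)$ is $\varphi(x_0,\dots,x_{k-1})$. The number $n_q(A)$ of queries of $A$ is the sum of the numbers of queries of $A_0,\dots,A_{k-1}$.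 For a map $S$ into $G$ and a set $F$ of functions, the $n$-th minimal query error is $$e_n^q(S,F)=\inf_{A:\ n_q(A)\le n}\ \sup_{f\in F}\ \inf\big\{\varepsilon\ge0:\ \mathbf P\{\|S(f)-A(f)\|>\varepsilon\}\le\tfrac14\big\}.$$ **Proposition.** Let $1\le p<\infty$. Then there is a constant $c>0$ (depending only on $p$) such that for all $n,M,N\in\{1,2,\dots\}$ with $$n\ge c\,M^{-p/2}N\max(\log(M^{-p}N),1)$$ we have $$e_n^q(S'_{N,M},\mathcal B_p^N)=0.$$ -/

import Mathlib

open scoped ENNReal NNReal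

noncomputable section

namespace QuantumSummation

/-! ### Quantum queries

The space `H_m`, the `m`-fold tensor power of `ℂ²`, is represented in its canonical basis
`|0⟩, …, |2 ^ m - 1⟩`, indexed by `Fin (2 ^ m)`; operators on it are complex matrices over that
index type, and the unitary operators are the elements of `Matrix.unitaryGroup`. -/

/-- A quantum query `Q = (m, m', m'', Z, τ, β)` on functions from `D` to `K`. -/
structure Query (D K : Type*) where
  /-- the number of qubits -/
  m : ℕ
  /-- the number of qubits of the address register -/
  m' : ℕ
  /-- the number of qubits of the value register -/
  m'' : ℕ
  m'_pos : 0 < m'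
  m''_pos : 0 < m''
  le_m : m' + m'' ≤ m
  /-- the set of valid addresses -/
  Z : Set (Fin (2 ^ m'))
  Z_nonempty : Z.Nonempty
  /-- the map that turns an address into a point of the domain -/
  τ : Z → D
  /-- the map that encodes a function value -/
  β : K → Fin (2 ^ m'')

namespace Query

variable {D K : Type*}

theorem two_pow_eq (Q : Query D K) :
    2 ^ Q.m' * (2 ^ Q.m'' * 2 ^ (Q.m - Q.m' - Q.m'')) = 2 ^ Q.m := by
  have h := Q.le_m
  rw [← pow_add, ← pow_add]
  congr 1
  omega

/-- The identification of `|i⟩|x⟩|y⟩` with a canonical basis vector of `H_m`; its index is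
`(i * 2 ^ m'' + x) * 2 ^ (m - m' - m'') + y` (the leading binary digits come first). -/
def split (Q : Query D K) :
    Fin (2 ^ Q.m') × Fin (2 ^ Q.m'') × Fin (2 ^ (Q.m - Q.m' - Q.m'')) ≃ Fin (2 ^ Q.m) :=
  ((Equiv.prodCongr (Equiv.refl _) finProdFinEquiv).trans finProdFinEquiv).trans
    (finCongr Q.two_pow_eq)

open Classical in
/-- The action of `Q_f` on triples: `(i, x, y) ↦ (i, x ⊕ β (f (τ i)), y)` if `i ∈ Z`, and
`(i, x, y)` is fixed otherwise. Addition in `Fin (2 ^ m'')` is addition modulo `2 ^ m''`. -/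
def act (Q : Query D K) (f : D → K)
    (t : Fin (2 ^ Q.m') × Fin (2 ^ Q.m'') × Fin (2 ^ (Q.m - Q.m' - Q.m''))) :
    Fin (2 ^ Q.m') × Fin (2 ^ Q.m'') × Fin (2 ^ (Q.m - Q.m' - Q.m'')) :=
  if h : t.1 ∈ Q.Z then (t.1, t.2.1 + Q.β (f (Q.τ ⟨t.1, h⟩)), t.2.2) else t

/-- The matrix of the unitary operator `Q_f` on `H_m` in the canonical basis. -/
def op (Q : Query D K) (f : D → K) : Matrix (Fin (2 ^ Q.m)) (Fin (2 ^ Q.m)) ℂ :=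
  Matrix.of fun u v => if u = Q.split (Q.act f (Q.split.symm v)) then 1 else 0

end Query

/-! ### Quantum algorithms -/

/-- The product `U_n * B * U_{n-1} * ⋯ * U_1 * B * U_0`. -/
def alternatingProd {ι : Type*} [Fintype ι] [DecidableEq ι] (B : Matrix ι ι ℂ) :
    (n : ℕ) → (Fin (n + 1) → Matrix.unitaryGroup ι ℂ) → Matrix ι ι ℂ
  | 0, U => (U 0 : Matrix ι ι ℂ)
  | n + 1, U =>
      (U (Fin.last (n + 1)) : Matrix ι ι ℂ) * B * alternatingProd B n (fun j => U j.castSucc)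

/-- A quantum algorithm with no measurement: a query and unitary operators `U_0, …, U_n`. -/
structure UnmeasuredAlgorithm (D K : Type*) where
  /-- the query -/
  Q : Query D K
  /-- the number of queries -/
  n : ℕ
  /-- the unitary operators between the query calls -/
  U : Fin (n + 1) → Matrix.unitaryGroup (Fin (2 ^ Q.m)) ℂ

namespace UnmeasuredAlgorithm

variable {D K : Type*}

/-- The number of qubits. -/
def qubits (A : UnmeasuredAlgorithm D K) : ℕ := A.Q.m

/-- The matrix `A_f(x, y)` of `A_f = U_n Q_f U_{n-1} ⋯ U_1 Q_f U_0` in the canonical basis. -/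
def op (A : UnmeasuredAlgorithm D K) (f : D → K) :
    Matrix (Fin (2 ^ A.qubits)) (Fin (2 ^ A.qubits)) ℂ :=
  alternatingProd (A.Q.op f) A.n A.U

end UnmeasuredAlgorithm

/-- A quantum algorithm with `k ≥ 1` measurements and output in `G`. The initial basis state
`b ℓ` of the `ℓ`-th cycle is a function of the measurement results of the cycles `i < ℓ` (so
`b 0` is a fixed basis state), and `φ` computes the output from all the results. -/
structure Algorithm (D K G : Type*) where
  /-- the number of measurements -/
  k : ℕ
  k_pos : 0 < k
  /-- the algorithms between the measurements -/
  A : Fin k → UnmeasuredAlgorithm D K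
  /-- the initial basis states -/
  b : (ℓ : Fin k) → ((i : Fin k) → i < ℓ → Fin (2 ^ (A i).qubits)) → Fin (2 ^ (A ℓ).qubits)
  /-- the output map -/
  φ : ((ℓ : Fin k) → Fin (2 ^ (A ℓ).qubits)) → G

namespace Algorithm

variable {D K G : Type*}

/-- The total number `n_q(A)` of queries. -/
def queries (A : Algorithm D K G) : ℕ := ∑ ℓ, (A.A ℓ).n

/-- The probability `p_{A,f}(x_0, …, x_{k-1})` of the measurement results `x_0, …, x_{k-1}`. -/
def resultProb (A : Algorithm D K G) (f : D → K) (x : (ℓ : Fin A.k) → Fin (2 ^ (A.A ℓ).qubits)) :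
    ℝ :=
  ∏ ℓ, ‖(A.A ℓ).op f (x ℓ) (A.b ℓ fun i _ => x i)‖ ^ 2

open Classical in
/-- The output distribution `A(f)`: the probability that the output lies in `C ⊆ G`. -/
def outputProb (A : Algorithm D K G) (f : D → K) (C : Set G) : ℝ :=
  ∑ x with A.φ x ∈ C, A.resultProb f x

variable [NormedAddCommGroup G]

/-- The error `e(S, A, f, θ)`: the infimum of all `ε` such that the output deviates from `S f`
by more than `ε` with probability at most `θ`. -/
def errorAt (S : (D → K) → G) (A : Algorithm D K G) (f : D → K) (θ : ℝ) : ℝ≥0∞ :=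
  ⨅ (ε : ℝ≥0) (_ : A.outputProb f {g | (ε : ℝ) < ‖S f - g‖} ≤ θ), (ε : ℝ≥0∞)

/-- The error `e(S, A, F, θ)` over the class `F`. -/
def error (S : (D → K) → G) (A : Algorithm D K G) (F : Set (D → K)) (θ : ℝ) : ℝ≥0∞ :=
  ⨆ f ∈ F, A.errorAt S f θ

end Algorithm

/-- The `n`-th minimal query error `e_n^q(S, F)`: the infimum of `e(S, A, F, 1/4)` over all quantum
algorithms `A` that use at most `n` queries. -/
def minQueryError {D K G : Type*} [NormedAddCommGroup G] (n : ℕ) (S : (D → K) → G)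
    (F : Set (D → K)) : ℝ≥0∞ :=
  ⨅ (A : Algorithm D K G) (_ : A.queries ≤ n), A.error S F (1 / 4)

/-! ### The summation problem -/

/-- The norm of `L_p^N`, for `1 ≤ p < ∞`. -/
def lpNorm (p : ℝ) (N : ℕ) (f : Fin N → ℝ) : ℝ :=
  ((1 / (N : ℝ)) * ∑ i, |f i| ^ p) ^ (1 / p)

/-- The unit ball of `L_p^N`. -/
def lpBall (p : ℝ) (N : ℕ) : Set (Fin N → ℝ) := {f | lpNorm p N f ≤ 1}

/-- The tail part of the mean: the sum of the entries with `|f i| ≥ M`, divided by `N`. -/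
def tailMean (N M : ℕ) (f : Fin N → ℝ) : ℝ :=
  (1 / (N : ℝ)) * ∑ i with (M : ℝ) ≤ |f i|, f i

end QuantumSummation

end

/-!
Let `K = N / M ^ p`. A function in the ball has at most `K` entries of absolute value at least `M`,
and it suffices to find all of them and to read their values to high precision.

One repetition of the algorithm runs `J` steps of Grover's search, with `J + 1` of order
`√(N / K) = M ^ (p / 2)`, and then reads the function value at the address found. The same query
serves both purposes: its lowest bit marks the large entries and the higher bits encode the value.
With the value register in a state proportional to `∑ x, (-1) ^ x |x⟩` the query multiplies the
amplitude of `|i⟩` by `-1` exactly at the large entries (`searchOp_mulVec_phaseVec`); with the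
register reset to `|0⟩` it writes down the value (`exists_search_unitaries`).

The number `t ≤ K` of large entries is unknown, but it need not be known. As `J` is below the
overshooting point even for `t = K`, the amplitude of each large entry grows linearly up to at least
`(J + 1) / √N` for every `t ≤ K` (`exists_groverAmplitude_eq`), so that each repetition hits each
given large entry with probability at least `(J + 1) ^ 2 / N`, which is of order `1 / K`
(`le_groverAmplitude_sq`). By a union bound (`sum_prod_le_of_missing`), `R` independent repetitions,
`R` of order `K log (4 K)`, find all large entries with probability at least `3 / 4`. This costs
`R (J + 1)` queries, of order `K M ^ (p / 2) log (4 K) = M ^ (-p / 2) N log (4 K)`.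

Values that are observed are correct up to the precision `ε` of the encoding. The number of queries
does not depend on `ε`, so the infimum of the errors is `0`
(`minQueryError_tailMean_eq_zero`).
-/

noncomputable section

namespace QuantumSummation

open Matrix

/-! ### Unitary matrices, queries and alternating products -/

/-- An orthonormal family extends to an orthonormal basis, so it can be prescribed as a family of
columns of a unitary matrix. -/
theorem exists_unitary_mulVec_single {κ ι : Type*} [Fintype ι] [DecidableEq ι] [DecidableEq κ]
    (e : κ ↪ ι) (w : κ → ι → ℂ)
    (hw : ∀ i j, star (w i) ⬝ᵥ w j = if i = j then 1 else 0) :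
    ∃ U ∈ unitaryGroup ι ℂ, ∀ k, U *ᵥ Pi.single (e k) 1 = w k := by
  classical
  let v : ι → EuclideanSpace ℂ ι := Function.extend e (fun k => WithLp.toLp 2 (w k)) 0
  have hv : ∀ k, v (e k) = WithLp.toLp 2 (w k) := fun k => e.injective.extend_apply _ _ _
  have hon : Orthonormal ℂ ((Set.range e).domRestrict v) := by
    rw [orthonormal_iff_ite]
    rintro ⟨_, i, rfl⟩ ⟨_, j, rfl⟩
    have h : inner ℂ (v (e i)) (v (e j)) = if i = j then (1 : ℂ) else 0 := by
      rw [hv, hv, EuclideanSpace.inner_eq_star_dotProduct, dotProduct_comm]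
      exact hw i j
    exact h.trans (if_congr ⟨fun h => Subtype.ext (congrArg e h),
      fun h => e.injective (congrArg Subtype.val h)⟩ rfl rfl)
  obtain ⟨b, hb⟩ := hon.exists_orthonormalBasis_extension_of_card_eq (by simp)
  refine ⟨(EuclideanSpace.basisFun ι ℂ).toBasis.toMatrix b.toBasis, ?_, fun k => ?_⟩
  · simpa using (EuclideanSpace.basisFun ι ℂ).toMatrix_orthonormalBasis_mem_unitary b
  · ext i
    simp [Module.Basis.toMatrix_apply, hb _ ⟨k, rfl⟩, hv]

/-- The reflection about the line spanned by a unit vector is unitary. -/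
theorem two_vecMulVec_sub_one_mem_unitaryGroup {ι : Type*} [Fintype ι] [DecidableEq ι]
    (ψ : ι → ℂ) (hψ : star ψ ⬝ᵥ ψ = 1) :
    (2 : ℂ) • vecMulVec ψ (star ψ) - 1 ∈ unitaryGroup ι ℂ := by
  have h1 : star (vecMulVec ψ (star ψ)) = vecMulVec ψ (star ψ) := by
    rw [star_eq_conjTranspose, conjTranspose_vecMulVec, star_star]
  have h2 : vecMulVec ψ (star ψ) * vecMulVec ψ (star ψ) = vecMulVec ψ (star ψ) := by
    rw [vecMulVec_mul_vecMulVec, hψ, one_smul]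
  rw [mem_unitaryGroup_iff, star_sub, star_smul, h1, star_one, sub_mul, mul_sub, mul_sub,
    smul_mul_smul_comm, h2]
  simp only [RCLike.star_def, map_ofNat, mul_one, one_mul]
  module

theorem Query.op_mulVec_single {D K : Type*} (Q : Query D K) (f : D → K)
    (t : Fin (2 ^ Q.m') × Fin (2 ^ Q.m'') × Fin (2 ^ (Q.m - Q.m' - Q.m''))) :
    Q.op f *ᵥ Pi.single (Q.split t) 1 = Pi.single (Q.split (Q.act f t)) 1 := by
  ext u
  simp [Query.op, Pi.single_apply]

/-- A unitary can be absorbed into the last factor of the alternating product. -/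
theorem alternatingProd_congr_last {ι : Type*} [Fintype ι] [DecidableEq ι] (B : Matrix ι ι ℂ)
    (W : unitaryGroup ι ℂ) (V : ℕ → unitaryGroup ι ℂ) (J : ℕ) :
    alternatingProd B J (fun i => if (i : ℕ) = J then W * V i else V i) =
      W * alternatingProd B J (fun i => V i) := by
  cases J with
  | zero => simp [alternatingProd]
  | succ J =>
    have h : ∀ j : Fin (J + 1), ¬ ((j : ℕ) = J + 1) := fun j => j.isLt.ne
    simp [alternatingProd, Matrix.mul_assoc, h]

/-! ### The search query and phase kickback -/

section Search

variable {K : Type*} {N w : ℕ}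

/-- The query on functions `Fin N → K` with `N` address qubits (enough, as `N < 2 ^ N`), of which
the addresses below `N` are valid, `w` value qubits and no workspace. -/
def searchQuery (hN : 0 < N) (hw : 0 < w) (β : K → Fin (2 ^ w)) : Query (Fin N) K where
  m := N + w
  m' := N
  m'' := w
  m'_pos := hN
  m''_pos := hw
  le_m := le_rfl
  Z := {z | z.val < N}
  Z_nonempty := ⟨⟨0, by positivity⟩, hN⟩
  τ z := ⟨z.1.val, z.2⟩
  β := β

/-- The index of the canonical basis vector `|i⟩|x⟩`, for a valid address `i`. -/
def searchPoint (hN : 0 < N) (hw : 0 < w) (β : K → Fin (2 ^ w)) (i : Fin N) (x : Fin (2 ^ w)) :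
    Fin (2 ^ (N + w)) :=
  (searchQuery hN hw β).split
    (Fin.castLE Nat.lt_two_pow_self.le i, x, ⟨0, pow_pos two_pos _⟩)

variable (hN : 0 < N) (hw : 0 < w) (β : K → Fin (2 ^ w))

/-- The matrix of the search query, with the dimension written as `2 ^ (N + w)` so that it matches
the vectors it acts on syntactically. -/
def searchOp (f : Fin N → K) : Matrix (Fin (2 ^ (N + w))) (Fin (2 ^ (N + w))) ℂ :=
  (searchQuery hN hw β).op f

theorem searchPoint_inj {i j : Fin N} {x y : Fin (2 ^ w)} :
    searchPoint hN hw β i x = searchPoint hN hw β j y ↔ i = j ∧ x = y := by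
  unfold searchPoint
  refine (EmbeddingLike.apply_eq_iff_eq _).trans ?_
  constructor
  · intro h
    have h1 : i.val = j.val := congrArg (fun t => t.1.val) h
    have h2 := congrArg (fun t => t.2.1) h
    exact ⟨Fin.ext h1, h2⟩
  · rintro ⟨rfl, rfl⟩
    simp

theorem searchOp_mulVec_single (f : Fin N → K) (i : Fin N) (x : Fin (2 ^ w)) :
    searchOp hN hw β f *ᵥ Pi.single (searchPoint hN hw β i x) 1 =
      Pi.single (searchPoint hN hw β i (x + β (f i))) 1 := by
  refine (Query.op_mulVec_single (searchQuery hN hw β) f _).trans ?_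
  congr 2
  have h : Fin.castLE Nat.lt_two_pow_self.le i ∈ (searchQuery hN hw β).Z := i.isLt
  exact dif_pos h

/-- The vector `|i⟩ ⊗ χ`, where `χ` is the normalized character `x ↦ (-1) ^ x` of the value
register. -/
def phaseVec (i : Fin N) : Fin (2 ^ (N + w)) → ℂ :=
  ∑ x : Fin (2 ^ w), (((-1) ^ x.val / √(2 ^ w) : ℝ) : ℂ) • Pi.single (searchPoint hN hw β i x) 1

theorem star_phaseVec_dotProduct (i j : Fin N) :
    star (phaseVec hN hw β i) ⬝ᵥ phaseVec hN hw β j = if i = j then 1 else 0 := by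
  have h : ∀ x y : Fin (2 ^ w),
      star (Pi.single (searchPoint hN hw β i x) (1 : ℂ)) ⬝ᵥ
        Pi.single (searchPoint hN hw β j y) (1 : ℂ) = if i = j ∧ x = y then 1 else 0 := by
    intro x y
    rw [dotProduct_single_one, Pi.star_apply, Pi.single_apply]
    simp only [searchPoint_inj, eq_comm]
    split_ifs <;> simp_all
  simp only [phaseVec, star_sum, star_smul, sum_dotProduct, dotProduct_sum, smul_dotProduct,
    dotProduct_smul, h]
  by_cases hij : i = j
  · have h2 : ∀ x : Fin (2 ^ w), (((-1) ^ x.val / √(2 ^ w) : ℝ) : ℂ) *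
        (((-1) ^ x.val / √(2 ^ w) : ℝ) : ℂ) = 1 / 2 ^ w := by
      intro x
      rw [← Complex.ofReal_mul, div_mul_div_comm, Real.mul_self_sqrt (by positivity),
        ← mul_pow]
      simp
    simp [hij, -Complex.ofReal_div, h2]
  · simp [hij]

/-- Addition modulo `2 ^ w` respects parity as `w` is positive, so `x ↦ (-1) ^ x` is a character. -/
theorem neg_one_pow_add_val (hw : 0 < w) (x b : Fin (2 ^ w)) :
    (-1 : ℝ) ^ (x + b).val = (-1) ^ x.val * (-1) ^ b.val := by
  have h2 : Even (2 ^ w) := (Nat.even_pow.2 ⟨even_two, hw.ne'⟩)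
  rw [← pow_add, Fin.val_add]
  conv_rhs => rw [← Nat.mod_add_div (x.val + b.val) (2 ^ w), pow_add, pow_mul, h2.neg_one_pow]
  simp

/-- Phase kickback: a character of the value register turns the addition of `β (f i)` into the sign
given by the lowest bit of `β (f i)`. -/
theorem searchOp_mulVec_phaseVec (f : Fin N → K) (i : Fin N) :
    searchOp hN hw β f *ᵥ phaseVec hN hw β i =
      ((-1 : ℝ) ^ (β (f i)).val : ℝ) • phaseVec hN hw β i := by
  have : NeZero (2 ^ w) := ⟨by positivity⟩
  unfold phaseVec
  rw [mulVec_sum, ← Equiv.sum_comp (Equiv.addRight (β (f i)))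
    (fun x => (((-1) ^ x.val / √(2 ^ w) : ℝ) : ℂ) • (Pi.single (searchPoint hN hw β i x) 1 :
      Fin (2 ^ (N + w)) → ℂ)), Finset.smul_sum]
  refine Finset.sum_congr rfl fun x _ => ?_
  rw [mulVec_smul, searchOp_mulVec_single, Equiv.coe_addRight, neg_one_pow_add_val hw,
    ← Complex.coe_smul, smul_smul, ← Complex.ofReal_mul]
  congr 2
  rw [mul_comm ((-1 : ℝ) ^ x.val), ← mul_div_assoc, ← mul_assoc, ← pow_add, ← two_mul, pow_mul]
  simp

/-! ### The evolution of the search state -/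

/-- The superposition of the vectors `|i⟩ ⊗ χ` with real amplitudes `g i`. -/
def phaseState (g : Fin N → ℝ) : Fin (2 ^ (N + w)) → ℂ :=
  ∑ i, (g i : ℂ) • phaseVec hN hw β i

theorem star_phaseState_dotProduct (g h : Fin N → ℝ) :
    star (phaseState hN hw β g) ⬝ᵥ phaseState hN hw β h = ((∑ i, g i * h i : ℝ) : ℂ) := by
  simp only [phaseState, star_sum, star_smul, sum_dotProduct, dotProduct_sum, smul_dotProduct,
    dotProduct_smul, star_phaseVec_dotProduct]
  simp [mul_comm]

theorem searchOp_mulVec_phaseState (f : Fin N → K) (g : Fin N → ℝ) :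
    searchOp hN hw β f *ᵥ phaseState hN hw β g =
      phaseState hN hw β (fun i => (-1) ^ (β (f i)).val * g i) := by
  simp only [phaseState, mulVec_sum, mulVec_smul, searchOp_mulVec_phaseVec]
  refine Finset.sum_congr rfl fun i _ => ?_
  rw [← Complex.coe_smul, smul_smul, ← Complex.ofReal_mul, mul_comm]

theorem sum_uniform_sq (hN : 0 < N) : ∑ _i : Fin N, (1 / √N) * (1 / √N) = (1 : ℝ) := by
  have : (0 : ℝ) < N := by exact_mod_cast hN
  simp only [Finset.sum_const, Finset.card_univ, Fintype.card_fin, nsmul_eq_mul]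
  rw [div_mul_div_comm, Real.mul_self_sqrt this.le]
  field_simp

/-- Grover's diffusion operator: the reflection about the uniform superposition. -/
def diffusion : unitaryGroup (Fin (2 ^ (N + w))) ℂ :=
  ⟨_, two_vecMulVec_sub_one_mem_unitaryGroup (phaseState hN hw β fun _ => 1 / √N) (by
    rw [star_phaseState_dotProduct, sum_uniform_sq hN, Complex.ofReal_one])⟩

theorem diffusion_mulVec_phaseState (g : Fin N → ℝ) :
    (diffusion hN hw β : Matrix _ _ ℂ) *ᵥ phaseState hN hw β g =
      phaseState hN hw β (fun i => 2 / N * ∑ k, g k - g i) := by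
  have hN0 : (0 : ℝ) ≤ N := by positivity
  simp only [diffusion, sub_mulVec, smul_mulVec, one_mulVec, vecMulVec_mulVec,
    star_phaseState_dotProduct]
  simp only [phaseState, op_smul_eq_smul, Finset.smul_sum, smul_smul, ← Finset.sum_sub_distrib,
    ← sub_smul]
  refine Finset.sum_congr rfl fun i _ => ?_
  congr 1
  rw [← Finset.mul_sum]
  have : (2 / N * ∑ k, g k : ℝ) = 2 * (1 / √N * ∑ k, g k) * (1 / √N) := by
    rw [show 2 * (1 / √N * ∑ k, g k) * (1 / √N) = 2 * (∑ k, g k) * (1 / (√N * √N)) by ring,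
      Real.mul_self_sqrt hN0]
    ring
  rw [this]
  push_cast
  ring

/-- The amplitude of the address `i` after `j` rounds of phase query and diffusion, when the phase
query multiplies the amplitude of `i` by `s i`. -/
def groverAmplitude (s : Fin N → ℝ) : ℕ → Fin N → ℝ
  | 0 => fun _ => 1 / √N
  | j + 1 => fun i => 2 / N * ∑ k, s k * groverAmplitude s j k - s i * groverAmplitude s j i

/-- There are a unitary that prepares the uniform superposition from a basis vector, and a unitary
that resets the value register from `χ` to `|0⟩`. -/
theorem exists_prepare_decode :
    ∃ P W : unitaryGroup (Fin (2 ^ (N + w))) ℂ,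
      (P : Matrix _ _ ℂ) *ᵥ Pi.single (searchPoint hN hw β ⟨0, hN⟩ ⟨0, by positivity⟩) 1 =
        phaseState hN hw β (fun _ => 1 / √N) ∧
      ∀ i, (W : Matrix _ _ ℂ) *ᵥ phaseVec hN hw β i =
        Pi.single (searchPoint hN hw β i ⟨0, by positivity⟩) 1 := by
  obtain ⟨P, hP, hP'⟩ := exists_unitary_mulVec_single
    (⟨fun _ : Unit => searchPoint hN hw β ⟨0, hN⟩ ⟨0, by positivity⟩, fun _ _ _ => rfl⟩)
    (fun _ => phaseState hN hw β fun _ => 1 / √N) (fun i j => by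
      rw [star_phaseState_dotProduct, sum_uniform_sq hN, Complex.ofReal_one, if_pos rfl])
  obtain ⟨V, hV, hV'⟩ := exists_unitary_mulVec_single
    (⟨fun i : Fin N => searchPoint hN hw β i ⟨0, by positivity⟩,
      fun i j h => ((searchPoint_inj hN hw β).1 h).1⟩)
    (phaseVec hN hw β) (star_phaseVec_dotProduct hN hw β)
  refine ⟨⟨P, hP⟩, star ⟨V, hV⟩, hP' (), fun i => ?_⟩
  rw [← hV', mulVec_mulVec]
  change (star V * V) *ᵥ _ = _
  rw [mem_unitaryGroup_iff'.1 hV, one_mulVec]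
  rfl

/-- The state after `J` phase queries, each followed by the diffusion. -/
theorem alternatingProd_mulVec (P : unitaryGroup (Fin (2 ^ (N + w))) ℂ)
    (v : Fin (2 ^ (N + w)) → ℂ)
    (hP : (P : Matrix _ _ ℂ) *ᵥ v = phaseState hN hw β (fun _ => 1 / √N)) (f : Fin N → K) (J : ℕ) :
    alternatingProd (searchOp hN hw β f) J
        (fun i => if (i : ℕ) = 0 then P else diffusion hN hw β) *ᵥ v =
      phaseState hN hw β (groverAmplitude (fun i => (-1) ^ (β (f i)).val) J) := by
  induction J with
  | zero => exact hP
  | succ J ih =>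
    simp only [alternatingProd, Fin.val_last, Nat.add_eq_zero_iff, one_ne_zero, and_false,
      if_false, Fin.val_castSucc, ← mulVec_mulVec, ih, searchOp_mulVec_phaseState,
      diffusion_mulVec_phaseState]
    rfl

/-- Unitaries which make `J + 1` queries produce the superposition of the `|i⟩|β (f i)⟩` with the
amplitudes of `J` Grover steps: the last query is made with the value register reset to `|0⟩`, so
that it writes the encoded function value there. -/
theorem exists_search_unitaries (J : ℕ) :
    ∃ U : Fin (J + 1 + 1) → unitaryGroup (Fin (2 ^ (N + w))) ℂ, ∀ f : Fin N → K,
      alternatingProd (searchOp hN hw β f) (J + 1) U *ᵥ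
          Pi.single (searchPoint hN hw β ⟨0, hN⟩ ⟨0, by positivity⟩) 1 =
        ∑ i, (groverAmplitude (fun i => (-1) ^ (β (f i)).val) J i : ℂ) •
          Pi.single (searchPoint hN hw β i (β (f i))) 1 := by
  obtain ⟨P, W, hP, hW⟩ := exists_prepare_decode hN hw β
  have : NeZero (2 ^ w) := ⟨by positivity⟩
  let V : ℕ → unitaryGroup (Fin (2 ^ (N + w))) ℂ := fun i => if i = 0 then P else diffusion hN hw β
  refine ⟨Fin.snoc (fun i : Fin (J + 1) => if (i : ℕ) = J then W * V i else V i) 1, fun f => ?_⟩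
  simp only [alternatingProd, Fin.snoc_last, Fin.snoc_castSucc, alternatingProd_congr_last,
    ← mulVec_mulVec]
  rw [alternatingProd_mulVec hN hw β P _ hP]
  simp only [phaseState, mulVec_sum, mulVec_smul, hW, OneMemClass.coe_one, one_mulVec,
    searchOp_mulVec_single]
  refine Finset.sum_congr rfl fun i _ => ?_
  congr 3
  exact zero_add (β (f i))

end Search

/-! ### Growth of the amplitudes -/

theorem sum_groverAmplitude_sq {N : ℕ} (hN : 0 < N) (s : Fin N → ℝ) (hs : ∀ i, s i ^ 2 = 1)
    (j : ℕ) : ∑ i, groverAmplitude s j i ^ 2 = 1 := by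
  induction j with
  | zero => simpa only [groverAmplitude, sq] using sum_uniform_sq hN
  | succ j ih =>
    have hN' : (N : ℝ) ≠ 0 := by positivity
    simp only [groverAmplitude, sub_sq, mul_pow (s _), hs, one_mul, Finset.sum_add_distrib,
      Finset.sum_sub_distrib, ih, ← Finset.mul_sum, Finset.sum_const, Finset.card_univ,
      Fintype.card_fin, nsmul_eq_mul]
    field_simp
    ring

/-- If `T` is the set of sign changes and `4 |T| j² ≤ N`, then after `j` steps the amplitudes times
`√N` take one value `a` on `T` and one value `b` off `T`. With `r = |T| / N`, their mean after the
next sign change is `μ = (1 - r) b - r a`. One step turns `a` into `a + 2 μ` and `μ` into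
`μ - 2 r (a + 2 μ)`: as long as `μ` stays in `[1 / 2, 1]`, the amplitude `a` grows by at least `1`
and at most `2`, and the upper bound on `a` controls the decrease of `μ`. -/
theorem exists_groverAmplitude_eq {N : ℕ} (hN : 0 < N) (T : Finset (Fin N)) (s : Fin N → ℝ)
    (hs : ∀ i, s i = if i ∈ T then -1 else 1) (j : ℕ) (hj : 4 * (T.card : ℝ) * j ^ 2 ≤ N) :
    ∃ a b : ℝ, (∀ i, groverAmplitude s j i = (if i ∈ T then a else b) / √N) ∧
      j + 1 ≤ a ∧ a ≤ 2 * j + 1 ∧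
      1 - 2 * (T.card / N) * (j + 1) ^ 2 ≤ (1 - T.card / N) * b - T.card / N * a ∧
      (1 - T.card / N) * b - T.card / N * a ≤ 1 := by
  have hN' : (0 : ℝ) < N := by exact_mod_cast hN
  set r : ℝ := T.card / N with hr
  have hr0 : 0 ≤ r := by positivity
  induction j with
  | zero =>
    refine ⟨1, 1, fun i => by simp [groverAmplitude], ?_, ?_, ?_, ?_⟩ <;> norm_num <;> linarith
  | succ j ih =>
    push_cast at hj
    have hT0 : (0 : ℝ) ≤ T.card := by positivity
    obtain ⟨a, b, hg, ha1, ha2, hm1, hm2⟩ := ih (le_trans (by gcongr; linarith) hj)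
    have hrj : 4 * r * ((j : ℝ) + 1) ^ 2 ≤ 1 := by
      rw [hr, show 4 * ((T.card : ℝ) / N) * ((j : ℝ) + 1) ^ 2 =
        4 * (T.card : ℝ) * ((j : ℝ) + 1) ^ 2 / N by ring]
      exact (div_le_one hN').2 hj
    set μ : ℝ := (1 - r) * b - r * a with hμ
    have hsum : 2 / N * ∑ k, s k * groverAmplitude s j k = 2 * μ / √N := by
      have h1 : ∀ k, s k * groverAmplitude s j k = if k ∈ T then -a / √N else b / √N := by
        intro k
        rw [hs, hg]
        split_ifs <;> ring
      have h2 : ((Finset.univ.filter fun k => k ∉ T).card : ℝ) = N - T.card := by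
        rw [Finset.filter_not, Finset.filter_univ_mem, ← Finset.compl_eq_univ_sdiff,
          Finset.card_compl, Nat.cast_sub (Finset.card_le_univ T), Fintype.card_fin]
      simp only [h1, Finset.sum_ite, Finset.sum_const, nsmul_eq_mul, h2, Finset.filter_univ_mem]
      rw [hμ, hr]
      field_simp
      ring
    have h3 : (1 - r) * (2 * μ - b) - r * (a + 2 * μ) = μ - 2 * r * (a + 2 * μ) := by
      rw [hμ]; ring
    refine ⟨a + 2 * μ, 2 * μ - b, fun i => ?_, ?_, ?_, ?_, ?_⟩
    · rw [groverAmplitude]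
      simp only [hsum]
      rw [hs, hg]
      split_ifs <;> ring
    · push_cast
      linarith
    · push_cast
      linarith
    · have h4 : r * (a + 2 * μ) ≤ r * (2 * j + 3) :=
        mul_le_mul_of_nonneg_left (by linarith) hr0
      rw [h3]
      push_cast
      nlinarith
    · have h4 : 0 ≤ r * (a + 2 * μ) := by
        have : (0 : ℝ) ≤ j := by positivity
        have : 0 ≤ a + 2 * μ := by linarith
        positivity
      rw [h3]
      linarith

theorem le_groverAmplitude_sq {N : ℕ} (hN : 0 < N) (T : Finset (Fin N)) (s : Fin N → ℝ)
    (hs : ∀ i, s i = if i ∈ T then -1 else 1) (j : ℕ) (hj : 4 * (T.card : ℝ) * j ^ 2 ≤ N)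
    {i : Fin N} (hi : i ∈ T) : ((j : ℝ) + 1) ^ 2 / N ≤ groverAmplitude s j i ^ 2 := by
  obtain ⟨a, b, hg, ha, -⟩ := exists_groverAmplitude_eq hN T s hs j hj
  rw [hg, if_pos hi, div_pow, Real.sq_sqrt (by positivity)]
  gcongr

/-! ### Independent repetitions -/

/-- In `R` independent draws from the distribution `q`, carried by the range of `e`, the probability
that some `e i` with `i ∈ T` is never drawn is at most `|T| (1 - δ) ^ R`, if each of them has
probability at least `δ`. -/
theorem sum_prod_le_of_missing {κ ι : Type*} [Fintype ι] [DecidableEq ι] (e : κ → ι) (q : ι → ℝ)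
    (hq0 : ∀ u, 0 ≤ q u) (hq1 : ∑ u, q u = 1) (hqe : ∀ u, u ∉ Set.range e → q u = 0)
    (T : Finset κ) (δ : ℝ) (hδ : ∀ i ∈ T, δ ≤ q (e i)) (R : ℕ) (B : Finset (Fin R → ι))
    (hB : ∀ x ∈ B, (∀ ℓ, x ℓ ∈ Set.range e) → ∃ i ∈ T, ∀ ℓ, x ℓ ≠ e i) :
    ∑ x ∈ B, ∏ ℓ, q (x ℓ) ≤ T.card * (1 - δ) ^ R := by
  -- `g i` is `q` with the mass at `e i` removed
  obtain ⟨g, hg0, hgq, hg1⟩ : ∃ g : κ → ι → ℝ, (∀ i u, 0 ≤ g i u) ∧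
      (∀ i u, u ≠ e i → g i u = q u) ∧ ∀ i, ∑ u, g i u = 1 - q (e i) := by
    refine ⟨fun i u => if u ≠ e i then q u else 0, fun i u => ?_, fun i u hu => if_pos hu,
      fun i => ?_⟩
    · dsimp only
      split_ifs
      exacts [hq0 u, le_rfl]
    · rw [← Finset.sum_filter, Finset.filter_ne', eq_sub_iff_add_eq,
        Finset.sum_erase_add _ _ (Finset.mem_univ (e i)), hq1]
  have hnn : ∀ (i : κ) (x : Fin R → ι), 0 ≤ ∏ ℓ, g i (x ℓ) := fun i x =>
    Finset.prod_nonneg fun ℓ _ => hg0 i _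
  calc ∑ x ∈ B, ∏ ℓ, q (x ℓ)
      ≤ ∑ x ∈ B, ∑ i ∈ T, ∏ ℓ, g i (x ℓ) := by
        refine Finset.sum_le_sum fun x hx => ?_
        by_cases hr : ∀ ℓ, x ℓ ∈ Set.range e
        · obtain ⟨i, hi, hne⟩ := hB x hx hr
          rw [Finset.prod_congr rfl fun ℓ _ => (hgq i _ (hne ℓ)).symm]
          exact Finset.single_le_sum (f := fun i => ∏ ℓ, g i (x ℓ)) (fun i _ => hnn i x) hi
        · push Not at hr
          obtain ⟨ℓ, hℓ⟩ := hr
          rw [Finset.prod_eq_zero (Finset.mem_univ ℓ) (hqe _ hℓ)]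
          exact Finset.sum_nonneg fun i _ => hnn i x
    _ ≤ ∑ x : Fin R → ι, ∑ i ∈ T, ∏ ℓ, g i (x ℓ) :=
        Finset.sum_le_univ_sum_of_nonneg fun x => Finset.sum_nonneg fun i _ => hnn i x
    _ = ∑ i ∈ T, (1 - q (e i)) ^ R := by
        rw [Finset.sum_comm]
        refine Finset.sum_congr rfl fun i _ => ?_
        rw [← hg1, Fintype.sum_pow]
    _ ≤ ∑ i ∈ T, (1 - δ) ^ R := by
        refine Finset.sum_le_sum fun i hi => ?_
        have h1 : 0 ≤ 1 - q (e i) := hg1 i ▸ Finset.sum_nonneg fun u _ => hg0 i u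
        exact pow_le_pow_left₀ h1 (by linarith [hδ i hi]) R
    _ = T.card * (1 - δ) ^ R := by rw [Finset.sum_const, nsmul_eq_mul]

/-! ### Encoding of the values, and the unit ball -/

/-- Numbers in `[-N, N]` can be encoded in finitely many bits so that the lowest bit records whether
`M ≤ |y|` and the other bits determine `y` up to `ε`. -/
theorem exists_encoding (N M : ℕ) {ε : ℝ} (hε : 0 < ε) :
    ∃ w : ℕ, 0 < w ∧ ∃ (β : ℝ → Fin (2 ^ w)) (dec : Fin (2 ^ w) → ℝ), ∀ y : ℝ, |y| ≤ N →
      (Odd (β y).val ↔ (M : ℝ) ≤ |y|) ∧ |y - dec (β y)| ≤ ε := by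
  classical
  set m : ℝ → ℕ := fun y => ⌊(y + N) / ε⌋₊ with hm
  set c : ℝ → ℕ := fun y => 2 * m y + if (M : ℝ) ≤ |y| then 1 else 0 with hc
  -- `c y ≤ w < 2 ^ w` for `|y| ≤ N`, so that reduction modulo `2 ^ w` loses nothing there
  set w : ℕ := 2 * m N + 2 with hw
  refine ⟨w, by omega, fun y => ⟨c y % 2 ^ w, Nat.mod_lt _ (by positivity)⟩,
    fun v => ε * (v.val / 2 : ℕ) - N, fun y hy => ?_⟩
  obtain ⟨hy1, hy2⟩ := abs_le.1 hy
  have hle : m y ≤ m N := Nat.floor_mono (by gcongr)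
  have hlt : c y < 2 ^ w := by
    refine lt_of_le_of_lt ?_ (Nat.lt_two_pow_self (n := w))
    simp only [hc]
    split_ifs <;> omega
  have hdiv : c y / 2 = m y := by
    simp only [hc]
    split_ifs <;> omega
  simp only [Nat.mod_eq_of_lt hlt, hdiv]
  constructor
  · simp only [hc]
    split_ifs with h
    · simp [h]
    · simp [h]
  · have h0 : 0 ≤ (y + N) / ε := div_nonneg (by linarith) hε.le
    have h1 : (m y : ℝ) * ε ≤ y + N := (le_div_iff₀ hε).1 (Nat.floor_le h0)
    have h2 : y + N < (m y + 1) * ε := (div_lt_iff₀ hε).1 (Nat.lt_floor_add_one _)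
    rw [abs_le]
    constructor <;> linarith

theorem sum_abs_rpow_le_of_mem_lpBall {p : ℝ} (hp : 1 ≤ p) {N : ℕ} (hN : 0 < N) {f : Fin N → ℝ}
    (hf : f ∈ lpBall p N) : ∑ i, |f i| ^ p ≤ N := by
  have hN' : (0 : ℝ) < N := by exact_mod_cast hN
  have h : ((1 / (N : ℝ)) * ∑ i, |f i| ^ p) ^ (1 / p) ≤ 1 := hf
  have h0 : 0 ≤ (1 / (N : ℝ)) * ∑ i, |f i| ^ p :=
    mul_nonneg (by positivity) (Finset.sum_nonneg fun i _ => by positivity)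
  by_contra! hlt
  refine absurd h (not_le.2 (Real.one_lt_rpow ?_ (by positivity)))
  rw [one_div, inv_mul_eq_div]
  exact (one_lt_div hN').2 hlt

theorem abs_le_of_mem_lpBall {p : ℝ} (hp : 1 ≤ p) {N : ℕ} (hN : 0 < N) {f : Fin N → ℝ}
    (hf : f ∈ lpBall p N) (i : Fin N) : |f i| ≤ N := by
  have h := sum_abs_rpow_le_of_mem_lpBall hp hN hf
  have h1 : |f i| ^ p ≤ ∑ i, |f i| ^ p :=
    Finset.single_le_sum (f := fun i => |f i| ^ p) (fun i _ => by positivity) (Finset.mem_univ i)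
  by_contra! hlt
  have h2 : (1 : ℝ) ≤ |f i| := le_trans (by exact_mod_cast hN) hlt.le
  -- `|f i| ≤ |f i| ^ p`, since `1 ≤ N < |f i|`
  have h3 := Real.self_le_rpow_of_one_le h2 hp
  linarith

theorem card_mul_rpow_le_of_mem_lpBall {p : ℝ} (hp : 1 ≤ p) {N : ℕ} (hN : 0 < N) (M : ℕ)
    {f : Fin N → ℝ} (hf : f ∈ lpBall p N) :
    ((Finset.univ.filter fun i => (M : ℝ) ≤ |f i|).card : ℝ) * (M : ℝ) ^ p ≤ N := by
  refine le_trans ?_ (sum_abs_rpow_le_of_mem_lpBall hp hN hf)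
  rw [← nsmul_eq_mul]
  refine le_trans (Finset.card_nsmul_le_sum _ (fun i => |f i| ^ p) _ fun i hi => ?_)
    (Finset.sum_le_univ_sum_of_nonneg fun i => by positivity)
  exact Real.rpow_le_rpow (by positivity) (Finset.mem_filter.1 hi).2 (by linarith)

/-! ### The algorithm and its error -/

section Algorithm

variable {N w : ℕ} (hN : 0 < N) (hw : 0 < w) (β : ℝ → Fin (2 ^ w)) (dec : Fin (2 ^ w) → ℝ)

open Classical in
/-- The estimate of the `i`-th entry of the tail read off the measurement results `x`: the decoded
value if the address `i` was observed together with an odd value register, and `0` otherwise. The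
choice among several observed values is irrelevant, since results that occur with positive
probability all carry the same value. -/
def decodeEntry {R : ℕ} (x : Fin R → Fin (2 ^ (N + w))) (i : Fin N) : ℝ :=
  if h : ∃ v : Fin (2 ^ w), Odd v.val ∧ ∃ ℓ, x ℓ = searchPoint hN hw β i v then dec h.choose else 0

/-- The algorithm that repeats `R` times, from the same basis state, the search with `J` Grover
steps and one reading query, and outputs the mean of the decoded entries. -/
def searchAlgorithm (J : ℕ) {R : ℕ} (hR : 0 < R) : Algorithm (Fin N) ℝ ℝ where
  k := R
  k_pos := hR
  A _ := ⟨searchQuery hN hw β, J + 1, (exists_search_unitaries hN hw β J).choose⟩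
  b _ _ := searchPoint hN hw β ⟨0, hN⟩ ⟨0, by positivity⟩
  φ x := 1 / N * ∑ i, decodeEntry hN hw β dec x i

theorem queries_searchAlgorithm (J : ℕ) {R : ℕ} (hR : 0 < R) :
    (searchAlgorithm hN hw β dec J hR).queries = R * (J + 1) := by
  change ∑ _ : Fin R, (J + 1) = _
  simp

open Classical in
/-- The distribution of the measurement result of one repetition. -/
def roundProb (J : ℕ) (f : Fin N → ℝ) (u : Fin (2 ^ (N + w))) : ℝ :=
  ∑ i, if u = searchPoint hN hw β i (β (f i)) then
    groverAmplitude (fun i => (-1) ^ (β (f i)).val) J i ^ 2 else 0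

theorem resultProb_searchAlgorithm (J : ℕ) {R : ℕ} (hR : 0 < R) (f : Fin N → ℝ)
    (x : Fin R → Fin (2 ^ (N + w))) :
    (searchAlgorithm hN hw β dec J hR).resultProb f x = ∏ ℓ, roundProb hN hw β J f (x ℓ) := by
  change ∏ ℓ : Fin R, ‖alternatingProd (searchOp hN hw β f) (J + 1)
    (exists_search_unitaries hN hw β J).choose (x ℓ)
    (searchPoint hN hw β ⟨0, hN⟩ ⟨0, by positivity⟩)‖ ^ 2 = _
  refine Finset.prod_congr rfl fun ℓ _ => ?_
  have h := congrFun ((exists_search_unitaries hN hw β J).choose_spec f) (x ℓ)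
  rw [mulVec_single_one] at h
  rw [col_apply, Finset.sum_apply] at h
  rw [h, roundProb]
  simp only [Pi.smul_apply, Pi.single_apply, smul_eq_mul, mul_ite, mul_one, mul_zero]
  by_cases hx : ∃ i, x ℓ = searchPoint hN hw β i (β (f i))
  · obtain ⟨i, hi⟩ := hx
    have h2 : ∀ j, x ℓ = searchPoint hN hw β j (β (f j)) ↔ i = j := by
      intro j
      rw [hi, searchPoint_inj]
      exact ⟨fun h => h.1, fun h => ⟨h, h ▸ rfl⟩⟩
    simp only [h2, Finset.sum_ite_eq, Finset.mem_univ, if_true, Complex.norm_real,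
      Real.norm_eq_abs, sq_abs]
  · push Not at hx
    simp [hx]

theorem roundProb_nonneg (J : ℕ) (f : Fin N → ℝ) (u : Fin (2 ^ (N + w))) :
    0 ≤ roundProb hN hw β J f u :=
  Finset.sum_nonneg fun i _ => by positivity

theorem sum_roundProb (J : ℕ) (f : Fin N → ℝ) : ∑ u, roundProb hN hw β J f u = 1 := by
  simp only [roundProb]
  rw [Finset.sum_comm]
  simp only [Finset.sum_ite_eq', Finset.mem_univ, if_true]
  refine sum_groverAmplitude_sq hN _ (fun i => ?_) J
  rw [← pow_mul, mul_comm, pow_mul]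
  simp

theorem roundProb_eq_zero (J : ℕ) (f : Fin N → ℝ) (u : Fin (2 ^ (N + w)))
    (hu : u ∉ Set.range fun i => searchPoint hN hw β i (β (f i))) :
    roundProb hN hw β J f u = 0 :=
  Finset.sum_eq_zero fun i _ => if_neg fun h => hu ⟨i, h.symm⟩

theorem roundProb_searchPoint (J : ℕ) (f : Fin N → ℝ) (i : Fin N) :
    roundProb hN hw β J f (searchPoint hN hw β i (β (f i))) =
      groverAmplitude (fun i => (-1) ^ (β (f i)).val) J i ^ 2 := by
  have h : ∀ j, searchPoint hN hw β i (β (f i)) = searchPoint hN hw β j (β (f j)) ↔ i = j := by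
    intro j
    rw [searchPoint_inj]
    exact ⟨fun h => h.1, fun h => ⟨h, h ▸ rfl⟩⟩
  simp [roundProb, h]

/-- Decoding is correct if every result has the form `|i⟩|β (f i)⟩` and every address with an odd
code was observed. -/
theorem decodeEntry_eq {R : ℕ} (x : Fin R → Fin (2 ^ (N + w))) (f : Fin N → ℝ)
    (hx : ∀ ℓ, ∃ i, searchPoint hN hw β i (β (f i)) = x ℓ)
    (hT : ∀ i, Odd (β (f i)).val → ∃ ℓ, x ℓ = searchPoint hN hw β i (β (f i))) (i : Fin N) :
    decodeEntry hN hw β dec x i = if Odd (β (f i)).val then dec (β (f i)) else 0 := by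
  have h : ∀ v ℓ, x ℓ = searchPoint hN hw β i v → v = β (f i) := by
    intro v ℓ h
    obtain ⟨j, hj⟩ := hx ℓ
    obtain ⟨rfl, rfl⟩ := (searchPoint_inj hN hw β).1 (hj.trans h)
    rfl
  unfold decodeEntry
  split_ifs with h1 h2 h2
  · obtain ⟨-, ℓ, hℓ⟩ := h1.choose_spec
    rw [h _ ℓ hℓ]
  · obtain ⟨ho, ℓ, hℓ⟩ := h1.choose_spec
    rw [h _ ℓ hℓ] at ho
    exact absurd ho h2
  · exact absurd ⟨_, h2, hT i h2⟩ h1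
  · rfl

theorem errorAt_searchAlgorithm_le (M J : ℕ) {R : ℕ} (hR : 0 < R) (ε : ℝ≥0) (f : Fin N → ℝ)
    (hβ : ∀ i, (Odd (β (f i)).val ↔ (M : ℝ) ≤ |f i|) ∧ |f i - dec (β (f i))| ≤ ε)
    (hJ : 4 * ((Finset.univ.filter fun i => (M : ℝ) ≤ |f i|).card : ℝ) * J ^ 2 ≤ N)
    (hfail : ((Finset.univ.filter fun i => (M : ℝ) ≤ |f i|).card : ℝ) *
      (1 - ((J : ℝ) + 1) ^ 2 / N) ^ R ≤ 1 / 4) :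
    (searchAlgorithm hN hw β dec J hR).errorAt (tailMean N M) f (1 / 4) ≤ ε := by
  classical
  refine iInf₂_le_of_le ε (le_trans ?_ hfail) le_rfl
  unfold Algorithm.outputProb
  set B : Finset (Fin R → Fin (2 ^ (N + w))) := Finset.univ.filter fun x =>
    (ε : ℝ) < ‖tailMean N M f - 1 / N * ∑ i, decodeEntry hN hw β dec x i‖ with hB
  have key : ∑ x ∈ B, ∏ ℓ, roundProb hN hw β J f (x ℓ) ≤
      ((Finset.univ.filter fun i => (M : ℝ) ≤ |f i|).card : ℝ) *
      (1 - ((J : ℝ) + 1) ^ 2 / N) ^ R := by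
    refine sum_prod_le_of_missing (fun i => searchPoint hN hw β i (β (f i)))
      (roundProb hN hw β J f) (roundProb_nonneg hN hw β J f) (sum_roundProb hN hw β J f)
      (roundProb_eq_zero hN hw β J f) _ _ (fun i hi => ?_) R B fun x hx hr => ?_
    · rw [roundProb_searchPoint]
      refine le_groverAmplitude_sq hN _ _ (fun k => ?_) J hJ hi
      by_cases hk : (M : ℝ) ≤ |f k|
      · simpa [hk] using ((hβ k).1.2 hk).neg_one_pow
      · have : Even (β (f k)).val := Nat.not_odd_iff_even.1 fun h => hk ((hβ k).1.1 h)
        simpa [hk] using this.neg_one_pow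
    · by_contra! hall
      refine absurd (Finset.mem_filter.1 hx).2 (not_lt.2 ?_)
      have hd := decodeEntry_eq hN hw β dec x f hr fun i hi =>
        hall i (Finset.mem_filter.2 ⟨Finset.mem_univ i, (hβ i).1.1 hi⟩)
      have hN' : (0 : ℝ) < N := by exact_mod_cast hN
      have hle : ∀ i : Fin N, |(if (M : ℝ) ≤ |f i| then f i else 0) -
          decodeEntry hN hw β dec x i| ≤ ε := by
        intro i
        rw [hd i, if_congr (hβ i).1 rfl rfl]
        split_ifs
        · exact (hβ i).2
        · simp
      rw [tailMean, Finset.sum_filter, ← mul_sub, ← Finset.sum_sub_distrib, Real.norm_eq_abs,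
        abs_mul, abs_of_pos (by positivity), one_div, inv_mul_le_iff₀ hN']
      refine (Finset.abs_sum_le_sum_abs _ _).trans
        ((Finset.sum_le_card_nsmul _ _ _ fun i _ => hle i).trans ?_)
      simp
  refine le_trans (le_of_eq ?_) key
  refine Finset.sum_congr ?_ fun x _ => resultProb_searchAlgorithm hN hw β dec J hR f x
  rfl

/-- The error vanishes as soon as `J` Grover steps do not overshoot and `R` repetitions find all
entries with probability `3 / 4`, for every number `t` of large entries that the ball allows. The
precision `ε` of the encoding is arbitrary, and does not affect the number of queries. -/
theorem minQueryError_tailMean_eq_zero {p : ℝ} (hp : 1 ≤ p) (hN : 0 < N) (n M J R : ℕ)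
    (hR : 0 < R) (hn : R * (J + 1) ≤ n)
    (h : ∀ t : ℕ, (t : ℝ) * (M : ℝ) ^ p ≤ N → 4 * (t : ℝ) * J ^ 2 ≤ N ∧
      (t : ℝ) * (1 - ((J : ℝ) + 1) ^ 2 / N) ^ R ≤ 1 / 4) :
    minQueryError n (tailMean N M) (lpBall p N) = 0 := by
  refine le_antisymm (ENNReal.le_of_forall_pos_le_add fun ε hε _ => ?_) bot_le
  rw [zero_add]
  obtain ⟨w, hw, β, dec, hβ⟩ := exists_encoding N M (ε := ε) hε
  refine iInf₂_le_of_le (searchAlgorithm hN hw β dec J hR)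
    (by rwa [queries_searchAlgorithm]) (iSup₂_le fun f hf => ?_)
  obtain ⟨h1, h2⟩ := h _ (card_mul_rpow_le_of_mem_lpBall hp hN M hf)
  exact errorAt_searchAlgorithm_le hN hw β dec M J hR ε f
    (fun i => hβ _ (abs_le_of_mem_lpBall hp hN hf i)) h1 h2

end Algorithm

end QuantumSummation

end

theorem proposition1 (p : ℝ) (hp : 1 ≤ p) :
    ∃ c : ℝ, 0 < c ∧ ∀ n M N : ℕ, 0 < n → 0 < M → 0 < N →
      c * (M : ℝ) ^ (-(p / 2)) * (N : ℝ) * max (Real.logb 2 ((M : ℝ) ^ (-p) * (N : ℝ))) 1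
        ≤ (n : ℝ) →
      QuantumSummation.minQueryError n (QuantumSummation.tailMean N M)
        (QuantumSummation.lpBall p N) = 0 := by
  refine ⟨96, by norm_num, fun n M N hn hM hN hle => ?_⟩
  have hM1 : (1 : ℝ) ≤ M := by exact_mod_cast hM
  have hN0 : (0 : ℝ) < N := by exact_mod_cast hN
  -- `X = M ^ (p / 2)`, and `K = N / X ^ 2` bounds the number of large entries
  set X : ℝ := (M : ℝ) ^ (p / 2) with hX
  have hX1 : 1 ≤ X := Real.one_le_rpow hM1 (by linarith)
  have hX0 : 0 < X := by linarith
  have hXp : (M : ℝ) ^ p = X ^ 2 := by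
    rw [hX, ← Real.rpow_natCast, ← Real.rpow_mul (by positivity)]
    congr 1
    push_cast
    ring
  rw [Real.rpow_neg (by positivity), Real.rpow_neg (by positivity), ← hX, hXp] at hle
  set K : ℝ := (X ^ 2)⁻¹ * N with hK
  have hKX : K * X ^ 2 = N := by rw [hK]; field_simp
  -- for `K < 1` there are no large entries, and one query (allowed as `0 < n`) is already enough
  rcases lt_or_ge K 1 with hK1 | hK1
  · refine QuantumSummation.minQueryError_tailMean_eq_zero hp hN n M 0 1 one_pos (by omega)
      fun t ht => ?_
    have ht0 : t = 0 := by
      by_contra h0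
      have h1 : (1 : ℝ) ≤ t := by exact_mod_cast Nat.one_le_iff_ne_zero.2 h0
      rw [hXp, ← hKX] at ht
      have := le_of_mul_le_mul_right ht (by positivity)
      linarith
    subst ht0
    norm_num
  -- each repetition makes `J + 1`, of order `X`, queries and finds a given large entry with
  -- probability at least `(J + 1) ^ 2 / N ≥ 1 / (16 K)`; a union bound then asks for
  -- `R ≥ 16 K log (4 K)`
  · have hK0 : 0 < K := by linarith
    obtain ⟨J, hJ1, hJ2, hJ3⟩ : ∃ J : ℕ, 4 * (J : ℝ) ^ 2 ≤ X ^ 2 ∧ X / 4 ≤ (J : ℝ) + 1 ∧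
        (J : ℝ) + 1 ≤ X := by
      -- truncated subtraction gives `J = 0` for `X < 2`
      refine ⟨⌊X / 2⌋₊ - 1, ?_⟩
      rcases lt_or_ge X 2 with h2 | h2
      · have : ⌊X / 2⌋₊ = 0 := Nat.floor_eq_zero.2 (by linarith)
        rw [this]
        norm_num
        exact ⟨by positivity, by linarith, hX1⟩
      · have h3 : 1 ≤ ⌊X / 2⌋₊ := Nat.le_floor (by push_cast; linarith)
        have h4 : (⌊X / 2⌋₊ : ℝ) ≤ X / 2 := Nat.floor_le (by positivity)
        have h5 : X / 2 < ⌊X / 2⌋₊ + 1 := Nat.lt_floor_add_one _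
        have h6 : (1 : ℝ) ≤ ⌊X / 2⌋₊ := by exact_mod_cast h3
        rw [Nat.cast_sub h3]
        push_cast
        refine ⟨?_, by linarith, by linarith⟩
        have h7 : ((⌊X / 2⌋₊ : ℝ) - 1) ^ 2 ≤ (X / 2) ^ 2 :=
          pow_le_pow_left₀ (by linarith) (by linarith) 2
        linarith
    have hlog : 1 ≤ Real.log (4 * K) := by
      rw [Real.le_log_iff_exp_le (by linarith)]
      linarith [Real.exp_one_lt_d9]
    have hlog2 : Real.log (4 * K) ≤ 3 * max (Real.logb 2 K) 1 := by
      have h1 : Real.log (4 * K) = Real.log 2 * (2 + Real.logb 2 K) := by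
        rw [Real.log_mul (by norm_num) hK0.ne', Real.logb, mul_add,
          mul_div_cancel₀ _ (Real.log_pos (by norm_num)).ne',
          show (4 : ℝ) = 2 ^ 2 by norm_num, Real.log_pow]
        push_cast
        ring
      have h2 : 0 ≤ Real.logb 2 K := Real.logb_nonneg (by norm_num) hK1
      have h3 : Real.log 2 ≤ 1 := by linarith [Real.log_two_lt_d9]
      rw [h1]
      calc Real.log 2 * (2 + Real.logb 2 K) ≤ 1 * (2 + Real.logb 2 K) := by gcongr
        _ ≤ _ := by linarith [le_max_left (Real.logb 2 K) 1, le_max_right (Real.logb 2 K) 1]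
    set R : ℕ := ⌈16 * K * Real.log (4 * K)⌉₊ with hR
    have hKl : 1 ≤ K * Real.log (4 * K) := one_le_mul_of_one_le_of_one_le hK1 hlog
    have hR0 : 0 < R := Nat.ceil_pos.2 (by nlinarith)
    have hR1 : 16 * K * Real.log (4 * K) ≤ R := Nat.le_ceil _
    have hR2 : (R : ℝ) ≤ 32 * (K * Real.log (4 * K)) := by
      have := Nat.ceil_lt_add_one (a := 16 * K * Real.log (4 * K)) (by nlinarith)
      linarith
    refine QuantumSummation.minQueryError_tailMean_eq_zero hp hN n M J R hR0 ?_ fun t ht => ?_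
    · have : (R : ℝ) * (J + 1) ≤ n := by
        refine le_trans ?_ hle
        calc (R : ℝ) * (J + 1) ≤ 32 * (K * (3 * max (Real.logb 2 K) 1)) * X := by
              gcongr
              exact hR2.trans (by gcongr)
          _ = 96 * (K * X) * max (Real.logb 2 K) 1 := by ring
          _ = _ := by
              rw [hK]
              field_simp
      exact_mod_cast this
    · have htK : (t : ℝ) ≤ K := by
        rw [hXp, ← hKX] at ht
        exact le_of_mul_le_mul_right ht (by positivity)
      constructor
      · calc 4 * (t : ℝ) * J ^ 2 = t * (4 * J ^ 2) := by ring
          _ ≤ K * X ^ 2 := by gcongr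
          _ = N := hKX
      · rcases Nat.eq_zero_or_pos t with rfl | ht0
        · norm_num
        have hδ : 1 / (16 * K) ≤ ((J : ℝ) + 1) ^ 2 / N := by
          rw [← hKX]
          rw [div_le_div_iff₀ (by positivity) (by positivity)]
          have : (X / 4) ^ 2 ≤ ((J : ℝ) + 1) ^ 2 := by gcongr
          nlinarith
        have hδ1 : ((J : ℝ) + 1) ^ 2 / N ≤ 1 := by
          rw [div_le_one hN0, ← hKX]
          have : ((J : ℝ) + 1) ^ 2 ≤ X ^ 2 := by gcongr
          nlinarith [sq_nonneg X]
        calc (t : ℝ) * (1 - ((J : ℝ) + 1) ^ 2 / N) ^ R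
            ≤ K * Real.exp (-(1 / (16 * K))) ^ R := by
              have h1 : 1 - ((J : ℝ) + 1) ^ 2 / N ≤ Real.exp (-(1 / (16 * K))) := by
                linarith [Real.add_one_le_exp (-(1 / (16 * K)))]
              have h2 : 0 ≤ 1 - ((J : ℝ) + 1) ^ 2 / N := by linarith
              gcongr
          _ ≤ K * Real.exp (-Real.log (4 * K)) := by
              rw [← Real.exp_nat_mul]
              gcongr
              rw [mul_neg, mul_one_div, neg_le_neg_iff, le_div_iff₀ (by positivity)]
              linarith
          _ = 1 / 4 := by
              rw [Real.exp_neg, Real.exp_log (by positivity)]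
              field_simp
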